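/- Let $I$ and $O$ be finite disjoint sets of input and output propositions and $\Sigma = I \mathbin{\dot\cup} O$. A hyperproperty is a set of sets of infinite traces in $(2^\Sigma)^\omega$; a closed HyperLTL formula $\varphi$ over $\Sigma$ defines the hyperproperty of all trace sets that satisfy $\varphi$. The formula is universal if it has the form $\forall \pi_1 \ldots \forall \pi_k.\,\psi$ with $\psi$ quantifier-free. In the sequential trace input model, traces are produced one session after the other. A reactive system $S$ determines each output in $2^O$ from the (infinite) input sequences of the finished sessions and the finite input sequence read so far in the current session. A prefix $(U,u)$ consists of a finite sequence $U$ of infinite traces (finished sessions) and a finite trace $u$ (current session); $(U,u) \preceq (V,v)$ holds if either $U=V$ and $u$ is a prefix of $v$, or $V$ continues $U$ with a further session having $u$ as a prefix, and possibly with more sessions. A strategy is a function $\sigma : ((2^\Sigma)^\omega)^* \times (2^\Sigma)^* \to (2^I)^* \to 2^O$. It is losing with $(U,u)$ for a hyperproperty $H$ if there are inputs $v_0, v_1, \ldots \in (2^I)^\omega$ with $U \cup \{t_0,t_1,\ldots\} \notin H$, where $t_0 = u \cdot (v_0[0] \cup \sigma(U,u)(\epsilon)) \cdot (v_0[1] \cup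 \sigma(U,u)(v_0[0])) \cdots$ and, for $k \ge 1$, $t_k = (v_k[0] \cup \sigma(U t_0 \cdots t_{k-1}, \epsilon)(\epsilon)) \cdot (v_k[1] \cup \sigma(U t_0 \cdots t_{k-1}, \epsilon)(v_k[0])) \cdots$. A prefix is winning for $H$ if some strategy is not losing with it. An enforcement mechanism $\mathit{enf}$ is a computable transformation of reactive systems $S$, regarded as black boxes, into reactive systems $\mathit{enf}(S)$: a single algorithm computes each output of $\mathit{enf}(S)$ from the observed run of $S$ (its finished sessions, given as oracles, its current finite session, and its proposed next output). It is sound for $H$ if for all reactive systems $S$ and all infinite sequences of session inputs, the set of traces produced by $\mathit{enf}(S)$ is in $H$. It is transparent for $H$ if, whenever the prefix produced by a system $S$ with an input sequence $s$ is winning for $H$, it is a prefix (w.r.t. $\preceq$) of every prefix that $\mathit{enf}(S)$ produces with an input sequence $s' \succeq s$. A hyperproperty is enforceable if it has a sound and transparent enforcement mechanism. **Theorem.** In the sequential trace input model, enforceability of universal HyperLTL is undecidable: no algorithm decides, given finite $I$, $O$ and a closed universal HyperLTL formula $\varphi$ over $I \mathbin{\dot\cup} O$, whether the hyperproperty defined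 by $\varphi$ is enforceable. -/

import Mathlib

/-! ## Letters and traces

The alphabet is `Σ = I ⊎ O` with `I = Fin m` (inputs) and `O = Fin n` (outputs). Subsets are given
by characteristic functions, and `2^Σ` is identified with `2^I × 2^O`. -/

/-- `2^I`. -/
abbrev InLetter (m : ℕ) : Type := Fin m → Bool

/-- `2^O`. -/
abbrev OutLetter (n : ℕ) : Type := Fin n → Bool

/-- `2^Σ`: the pair `(i, o)` stands for `i ∪ o`. -/
abbrev Letter (m n : ℕ) : Type := InLetter m × OutLetter n

/-- Infinite words over `A`. -/
abbrev InfWord (A : Type) : Type := ℕ → A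

/-- The proposition `a` belongs to the letter `l`. -/
def Letter.Has {m n : ℕ} (l : Letter m n) : Fin m ⊕ Fin n → Prop
  | Sum.inl i => l.1 i = true
  | Sum.inr o => l.2 o = true

/-- The first `k` letters of an infinite word. -/
def InfWord.first {A : Type} (w : InfWord A) (k : ℕ) : List A :=
  (List.range k).map w

/-- The suffix of an infinite word from position `i`. -/
def InfWord.suffix {A : Type} (w : InfWord A) (i : ℕ) : InfWord A :=
  fun j => w (i + j)

/-- The infinite word `u · w`. -/
def InfWord.prepend {A : Type} (u : List A) (w : InfWord A) : InfWord A :=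
  fun j => if h : j < u.length then u[j] else w (j - u.length)

/-- A hyperproperty is a set of sets of infinite traces. -/
abbrev Hyperproperty (m n : ℕ) : Type := Set (Set (InfWord (Letter m n)))

/-! ## HyperLTL -/

/-- Quantifier-free HyperLTL formulas; trace variables are natural numbers. -/
inductive HyperBody (AP : Type) : Type
  | atom (a : AP) (x : ℕ) : HyperBody AP
  | neg (p : HyperBody AP) : HyperBody AP
  | or (p q : HyperBody AP) : HyperBody AP
  | next (p : HyperBody AP) : HyperBody AP
  | untl (p q : HyperBody AP) : HyperBody AP

/-- HyperLTL formulas: a prefix of trace quantifiers followed by a quantifier-free formula. -/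
inductive HyperLTL (AP : Type) : Type
  | body (p : HyperBody AP) : HyperLTL AP
  | all (x : ℕ) (f : HyperLTL AP) : HyperLTL AP
  | ex (x : ℕ) (f : HyperLTL AP) : HyperLTL AP

/-- The trace variables occurring in a quantifier-free formula. -/
def HyperBody.vars {AP : Type} : HyperBody AP → Set ℕ
  | atom _ x => {x}
  | neg p => p.vars
  | or p q => p.vars ∪ q.vars
  | next p => p.vars
  | untl p q => p.vars ∪ q.vars

/-- The free trace variables of a formula. -/
def HyperLTL.freeVars {AP : Type} : HyperLTL AP → Set ℕ
  | body p => p.vars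
  | all x f => f.freeVars \ {x}
  | ex x f => f.freeVars \ {x}

/-- No free trace variables. -/
def HyperLTL.IsClosed {AP : Type} (f : HyperLTL AP) : Prop := f.freeVars = ∅

/-- The universal fragment: all trace quantifiers are universal. -/
def HyperLTL.IsUniversal {AP : Type} : HyperLTL AP → Prop
  | body _ => True
  | all _ f => f.IsUniversal
  | ex _ _ => False

/-- Satisfaction of a quantifier-free formula by a trace assignment. -/
def HyperBody.Sat {m n : ℕ} :
    HyperBody (Fin m ⊕ Fin n) → (ℕ → InfWord (Letter m n)) → Prop
  | atom a x, A => (A x 0).Has a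
  | neg p, A => ¬ p.Sat A
  | or p q, A => p.Sat A ∨ q.Sat A
  | next p, A => p.Sat (fun x => (A x).suffix 1)
  | untl p q, A => ∃ i, q.Sat (fun x => (A x).suffix i) ∧
      ∀ j, j < i → p.Sat (fun x => (A x).suffix j)

/-- Satisfaction of a formula by a trace set and a trace assignment. -/
def HyperLTL.Sat {m n : ℕ} (T : Set (InfWord (Letter m n))) :
    HyperLTL (Fin m ⊕ Fin n) → (ℕ → InfWord (Letter m n)) → Prop
  | body p, A => p.Sat A
  | all x f, A => ∀ t ∈ T, f.Sat T (Function.update A x t)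
  | ex x f, A => ∃ t ∈ T, f.Sat T (Function.update A x t)

/-- The hyperproperty defined by a closed formula. The value of the initial trace assignment is
irrelevant for closed formulas; it plays the role of the empty assignment. -/
def HyperLTL.hyperproperty {m n : ℕ} (f : HyperLTL (Fin m ⊕ Fin n)) : Hyperproperty m n :=
  {T | f.Sat T (fun _ _ => (fun _ => false, fun _ => false))}

/-- Gödel numbering of quantifier-free formulas. -/
def HyperBody.code {AP : Type} [Encodable AP] : HyperBody AP → ℕ
  | atom a x => 5 * Nat.pair (Encodable.encode a) x
  | neg p => 5 * p.code + 1
  | or p q => 5 * Nat.pair p.code q.code + 2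
  | next p => 5 * p.code + 3
  | untl p q => 5 * Nat.pair p.code q.code + 4

/-- Gödel numbering of formulas. -/
def HyperLTL.code {AP : Type} [Encodable AP] : HyperLTL AP → ℕ
  | body p => 3 * p.code
  | all x f => 3 * Nat.pair x f.code + 1
  | ex x f => 3 * Nat.pair x f.code + 2

theorem HyperBody.code_injective {AP : Type} [Encodable AP] :
    Function.Injective (HyperBody.code (AP := AP)) := by
  intro p
  induction p with
  | atom a x =>
    intro q h
    cases q <;> simp only [HyperBody.code] at h <;> try omega
    have h' := Nat.pair_eq_pair.1 (Nat.eq_of_mul_eq_mul_left (by norm_num) h)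
    rw [Encodable.encode_injective h'.1, h'.2]
  | neg p ih =>
    intro q h
    cases q <;> simp only [HyperBody.code] at h <;> try omega
    exact congrArg _ (ih (by omega))
  | next p ih =>
    intro q h
    cases q <;> simp only [HyperBody.code] at h <;> try omega
    exact congrArg _ (ih (by omega))
  | or p q ihp ihq =>
    intro r h
    cases r <;> simp only [HyperBody.code] at h <;> try omega
    have h' := Nat.pair_eq_pair.1 (Nat.eq_of_mul_eq_mul_left (by norm_num) (Nat.add_right_cancel h))
    rw [ihp h'.1, ihq h'.2]
  | untl p q ihp ihq =>
    intro r h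
    cases r <;> simp only [HyperBody.code] at h <;> try omega
    have h' := Nat.pair_eq_pair.1 (Nat.eq_of_mul_eq_mul_left (by norm_num) (Nat.add_right_cancel h))
    rw [ihp h'.1, ihq h'.2]

theorem HyperLTL.code_injective {AP : Type} [Encodable AP] :
    Function.Injective (HyperLTL.code (AP := AP)) := by
  intro f
  induction f with
  | body p =>
    intro g h
    cases g <;> simp only [HyperLTL.code] at h <;> try omega
    rw [HyperBody.code_injective (Nat.eq_of_mul_eq_mul_left (by norm_num) h)]
  | all x f ih =>
    intro g h
    cases g <;> simp only [HyperLTL.code] at h <;> try omega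
    have h' := Nat.pair_eq_pair.1 (Nat.eq_of_mul_eq_mul_left (by norm_num) (Nat.add_right_cancel h))
    rw [h'.1, ih h'.2]
  | ex x f ih =>
    intro g h
    cases g <;> simp only [HyperLTL.code] at h <;> try omega
    have h' := Nat.pair_eq_pair.1 (Nat.eq_of_mul_eq_mul_left (by norm_num) (Nat.add_right_cancel h))
    rw [h'.1, ih h'.2]

/-! ## The sequential trace input model -/

/-- A prefix `(U, u)`: finitely many finished sessions and a finite current session. -/
abbrev SeqPrefix (A : Type) : Type := List (InfWord A) × List A

/-- `(U, u) ⪯ (V, v)`: either `U = V` and `u` is a prefix of `v`, or `V` continues `U` with a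
session that has `u` as a prefix and possibly with further sessions. -/
def SeqPrefix.Le {A : Type} (p q : SeqPrefix A) : Prop :=
  (p.1 = q.1 ∧ p.2 <+: q.2) ∨
    ∃ (w : InfWord A) (W : List (InfWord A)),
      q.1 = p.1 ++ w :: W ∧ p.2 = w.first p.2.length

/-- The trace obtained by answering the inputs `v` with `s : (2^I)^* → 2^O`; the output at
position `j` depends on the inputs at positions before `j`. -/
def respond {m n : ℕ} (s : List (InLetter m) → OutLetter n) (v : InfWord (InLetter m)) :
    InfWord (Letter m n) :=
  fun j => (v j, s (v.first j))

/-- Prefixed strategies `((2^Σ)^ω)^* × (2^Σ)^* → (2^I)^* → 2^O`. -/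
abbrev SeqStrategy (m n : ℕ) : Type :=
  SeqPrefix (Letter m n) → List (InLetter m) → OutLetter n

/-- The sequence `U, t₀, …, t_k` of sessions that results when `σ` continues the prefix
`p = (U, u)` on the inputs `V = (v₀, v₁, …)`. -/
def SeqStrategy.play {m n : ℕ} (σ : SeqStrategy m n) (p : SeqPrefix (Letter m n))
    (V : ℕ → InfWord (InLetter m)) : ℕ → List (InfWord (Letter m n))
  | 0 => p.1 ++ [InfWord.prepend p.2 (respond (σ p) (V 0))]
  | k + 1 => σ.play p V k ++ [respond (σ (σ.play p V k, [])) (V (k + 1))]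

/-- `σ` is losing with the prefix `p = (U, u)` for `H`: for some inputs, the set
`U ∪ {t₀, t₁, …}` is not in `H`. -/
def SeqStrategy.Losing {m n : ℕ} (σ : SeqStrategy m n) (p : SeqPrefix (Letter m n))
    (H : Hyperproperty m n) : Prop :=
  ∃ V : ℕ → InfWord (InLetter m), {t | ∃ k, t ∈ σ.play p V k} ∉ H

/-- A prefix is winning if some strategy is not losing with it. -/
def SeqPrefix.Winning {m n : ℕ} (p : SeqPrefix (Letter m n)) (H : Hyperproperty m n) : Prop :=
  ∃ σ : SeqStrategy m n, ¬ σ.Losing p H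

/-! ## Reactive systems and enforcement mechanisms -/

/-- A (black-box) reactive system in the sequential model: the inputs of the finished sessions and
the inputs seen so far in the current session determine the next output. -/
abbrev SeqSystem (m n : ℕ) : Type :=
  List (InfWord (InLetter m)) → List (InLetter m) → OutLetter n

/-- The traces of the sessions that `S` produces on the inputs `V = (v₀, v₁, …)`. -/
def SeqSystem.session {m n : ℕ} (S : SeqSystem m n) (V : ℕ → InfWord (InLetter m)) (k : ℕ) :
    InfWord (Letter m n) :=
  respond (S ((List.range k).map V)) (V k)

/-- The prefix that `S` produces with the input sequence `s = (V, v)`. -/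
def SeqSystem.run {m n : ℕ} (S : SeqSystem m n) (s : SeqPrefix (InLetter m)) :
    SeqPrefix (Letter m n) :=
  (List.ofFn fun k : Fin s.1.length => respond (S (s.1.take k)) s.1[k],
   List.ofFn fun j : Fin s.2.length => (s.2[j], S s.1 (s.2.take j)))

/-- `enf` is a computable transformation of black-box systems: one algorithm computes every output
of `enf S` from the observed behaviour of `S`, that is, the finished sessions of `S`, its current
finite session and its proposed next output. The finished sessions are infinite words, so the
algorithm is given their first `k` letters for `k = 0, 1, 2, …`, and answers `none` as long as it
has to read more. -/
def IsEnforcementMechanism {m n : ℕ} (enf : SeqSystem m n → SeqSystem m n) : Prop :=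
  ∃ F : ℕ × List (List (Letter m n)) × List (Letter m n) × OutLetter n → Option (OutLetter n),
    Computable F ∧
    ∀ (S : SeqSystem m n) (V : List (InfWord (InLetter m))) (v : List (InLetter m)),
      (∃ k, F (k, (S.run (V, v)).1.map (fun t => t.first k), (S.run (V, v)).2, S V v)
        = some (enf S V v)) ∧
      ∀ k o, F (k, (S.run (V, v)).1.map (fun t => t.first k), (S.run (V, v)).2, S V v) = some o →
        o = enf S V v

/-- Soundness: the set of traces produced by `enf S` is always in `H`. -/
def EnfSound {m n : ℕ} (enf : SeqSystem m n → SeqSystem m n) (H : Hyperproperty m n) : Prop :=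
  ∀ (S : SeqSystem m n) (V : ℕ → InfWord (InLetter m)), Set.range ((enf S).session V) ∈ H

/-- Transparency: if the prefix that `S` produces with the input sequence `s` is winning, then it
is a prefix of whatever `enf S` produces with an input sequence that extends `s`. -/
def EnfTransparent {m n : ℕ} (enf : SeqSystem m n → SeqSystem m n) (H : Hyperproperty m n) :
    Prop :=
  ∀ (S : SeqSystem m n) (s s' : SeqPrefix (InLetter m)),
    (S.run s).Winning H → s.Le s' → (S.run s).Le ((enf S).run s')

/-- `H` is enforceable in the sequential model: there is a sound and transparent enforcement
mechanism. -/
def Enforceable {m n : ℕ} (H : Hyperproperty m n) : Prop :=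
  ∃ enf : SeqSystem m n → SeqSystem m n,
    IsEnforcementMechanism enf ∧ EnfSound enf H ∧ EnfTransparent enf H

/-!
Non-halting of Turing machines is not recursively enumerable, and it is reduced to enforceability.
A machine whose tape is folded at the head is a one-sided array of cells with finitely many letters,
updated by a local rule. There is one input. A session in which it first occurs at position `t` is
made responsible for row `t` of the array: it has to write that row as its outputs after position
`t`. A universal formula over pairs of sessions prescribes row `0`, relates the rows of sessions
that are marked at consecutive positions by the local rule, and forbids halting letters at the
origin. In a trace set that contains a session for every row, all outputs are then forced. So if the
machine halts, no system can be sound once every row has been asked for. If it does not halt, one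
computable strategy that never looks at earlier sessions satisfies the formula, and every winning
prefix already agrees with it, so that replacing any system by this strategy is transparent.
-/

/-! ## Undecidability of halting -/

section UndecidabilityOfHalting

open Turing PartrecToTM2

theorem rePred_comp {α β : Type*} [Primcodable α] [Primcodable β] {p : β → Prop}
    (hp : REPred p) {f : α → β} (hf : Computable f) : REPred fun a => p (f a) :=
  Partrec.comp hp hf

theorem exists_toPartrec_code_not_rePred :
    ∃ c : ToPartrec.Code, ¬ REPred fun e : ℕ => ¬ (c.eval [e]).Dom := by
  let halting : ℕ →. ℕ := fun e => (Denumerable.ofNat Nat.Partrec.Code e).eval 0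
  have h_halting : Partrec halting :=
    Nat.Partrec.Code.eval_part.comp (Computable.ofNat _) (Computable.const 0)
  obtain ⟨c, hc⟩ := ToPartrec.Code.exists_code (Nat.Partrec'.part_iff₁.2 h_halting)
  have dom_iff (d : Nat.Partrec.Code) : (c.eval [Encodable.encode d]).Dom ↔ (d.eval 0).Dom := by
    have := hc (Encodable.encode d ::ᵥ List.Vector.nil)
    simp only [List.Vector.head_cons, halting, Denumerable.ofNat_encode] at this
    exact iff_of_eq (congrArg Part.Dom this)
  refine ⟨c, fun h => ComputablePred.halting_problem_not_re 0 ?_⟩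
  exact (rePred_comp h Computable.encode).of_eq fun d => not_congr (dom_iff d)

theorem bits_of_ne_zero {n : ℕ} (hn : n ≠ 0) : n.bits = n.bodd :: n.div2.bits := by
  rw [← Nat.bits_append_bit _ _ fun h => ?_, Nat.bit_bodd_div2]
  by_contra hb
  exact hn (by rw [← Nat.bit_bodd_div2 n, h, Bool.eq_false_of_not_eq_true hb]; rfl)

theorem primrec_bits : Primrec Nat.bits := by
  refine Primrec.nat_omega_rec' (m := id) (l := fun n => if n = 0 then [] else [n.div2])
    (g := fun n L => some (if n = 0 then [] else n.bodd :: L.flatten)) _ Primrec.id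
    (Primrec.ite (Primrec.eq.comp Primrec.id (Primrec.const 0)) (Primrec.const [])
      (Primrec.list_cons.comp Primrec.nat_div2 (Primrec.const [])))
    (Primrec.option_some.comp (Primrec.ite (Primrec.eq.comp Primrec.fst (Primrec.const 0))
      (Primrec.const []) (Primrec.list_cons.comp (Primrec.nat_bodd.comp Primrec.fst)
        (Primrec.list_flatten.comp Primrec.snd))))
    (fun n k hk => ?_) (fun n => ?_)
  · split_ifs at hk with hn
    · cases hk
    · rw [List.mem_singleton.1 hk, Nat.div2_val]
      exact Nat.div_lt_self (Nat.pos_of_ne_zero hn) one_lt_two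
  · by_cases hn : n = 0
    · simp [hn]
    · simp [hn, bits_of_ne_zero hn]

theorem trNat_eq_map_bits (n : ℕ) :
    trNat n = n.bits.map fun b => bif b then Γ'.bit1 else Γ'.bit0 := by
  induction n using Nat.binaryRec' with
  | zero => rfl
  | bit b n hb ih =>
    rw [Nat.bits_append_bit n b hb, List.map_cons, ← ih, trNat, trNat, ← Num.ofNat'_eq,
      Num.ofNat'_bit, Num.ofNat'_eq]
    cases h : (n : Num) with
    | zero =>
      have hn : n = 0 := Num.of_nat_inj.1 h
      rw [hb hn]
      rfl
    | pos q => cases b <;> rfl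

instance finite_stackIndex : Finite K' :=
  Fintype.finite ⟨{.main, .rev, .aux, .stack}, fun k => by cases k <;> decide⟩

/-- The tape symbol of the one-tape simulation of `PartrecToTM2` at a cell where the main stack
holds `a` and the other stacks are empty; the flag is `true` at the bottom of the stacks. -/
def mainStackSymbol (isBottom : Bool) (a : Γ') : TM2to1.Γ' K' fun _ => Γ' :=
  (isBottom, Function.update (fun _ => none) K'.main (some a))

theorem trInit_trList_singleton (e : ℕ) :
    TM2to1.trInit K'.main (trList [e]) = mainStackSymbol true Γ'.cons ::
      (e.bits.map fun b => mainStackSymbol false (bif b then Γ'.bit1 else Γ'.bit0)).reverse := by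
  have reverse_trList : (trList [e]).reverse = Γ'.cons :: (trNat e).reverse := by simp
  rw [TM2to1.trInit, reverse_trList, trNat_eq_map_bits, ← List.map_reverse, ← List.map_reverse]
  exact congrArg (_ :: ·) List.map_map

theorem tm2_init_eq_init (c : ToPartrec.Code) (v : List ℕ) :
    letI : Inhabited Λ' := ⟨trNormal c Cont'.halt⟩
    TM2.init K'.main (trList v) = PartrecToTM2.init c v := by
  simp only [TM2.init, PartrecToTM2.init]
  congr 1
  funext k
  cases k <;> rfl

theorem exists_tm0_not_rePred :
    ∃ (Γ Λ : Type) (_ : Inhabited Γ) (_ : Inhabited Λ) (_ : Finite Γ) (M : TM0.Machine Γ Λ)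
      (S : Set Λ) (x : Γ) (g : Bool → Γ), S.Finite ∧ TM0.Supports M S ∧
        ¬ REPred fun e : ℕ => ¬ (TM0.eval M (x :: (e.bits.map g).reverse)).Dom := by
  classical
  obtain ⟨c, hc⟩ := exists_toPartrec_code_not_rePred
  let _ : Inhabited Λ' := ⟨trNormal c Cont'.halt⟩
  have finite_alphabet : Finite (TM2to1.Γ' K' fun _ => Γ') :=
    inferInstanceAs (Finite (Bool × ∀ _ : K', Option Γ'))
  let step : Λ' → TM2.Stmt (fun _ : K' => Γ') Λ' (Option Γ') := tr
  have eval_dom_iff (e : ℕ) : (TM0.eval (TM1to0.tr (TM2to1.tr step))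
      (TM2to1.trInit K'.main (trList [e]))).Dom ↔ (c.eval [e]).Dom :=
    calc _ ↔ (TM2.eval step K'.main (trList [e])).Dom := by
          rw [TM1to0.tr_eval, TM2to1.tr_eval_dom]
      _ ↔ (StateTransition.eval (TM2.step step) (PartrecToTM2.init c [e])).Dom := by
          rw [← tm2_init_eq_init]; rfl
      _ ↔ (c.eval [e]).Dom := iff_of_eq (congrArg Part.Dom (PartrecToTM2.tr_eval c [e]))
  refine ⟨_, _, inferInstance, inferInstance, finite_alphabet, TM1to0.tr (TM2to1.tr step), _,
    mainStackSymbol true Γ'.cons,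
    fun b => mainStackSymbol false (bif b then Γ'.bit1 else Γ'.bit0), Finset.finite_toSet _,
    TM1to0.tr_supports _ (TM2to1.tr_supports _ (PartrecToTM2.tr_supports c Cont'.halt)),
    fun h => hc (h.of_eq fun e => ?_)⟩
  rw [← eval_dom_iff, trInit_trList_singleton]

end UndecidabilityOfHalting

/-! ## Turing machines as cell rules -/

/-- The local rule of a one-sided array of cells in which every cell sees its neighbours and the
cell at the origin, which has no left neighbour. The symbol `blank` fills initial rows, and the
letters in `halted` are those that end the computation when they appear at the origin. -/
structure CellRule (A : Type*) where
  boundary : A → A → A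
  interior : A → A → A → A → A
  blank : A
  halted : Set A

namespace CellRule

variable {A B : Type*}

/-- The row that holds the word `w`, followed by blanks. -/
def initRow (R : CellRule A) (w : List A) (p : ℕ) : A := w.getD p R.blank

/-- One simultaneous application of the rule to all cells of a row. -/
def next (R : CellRule A) (r : ℕ → A) : ℕ → A
  | 0 => R.boundary (r 0) (r 1)
  | p + 1 => R.interior (r 0) (r p) (r (p + 1)) (r (p + 2))

/-- The `t`-th row of the computation on the input word `w`. -/
def row (R : CellRule A) (w : List A) (t : ℕ) : ℕ → A := R.next^[t] (R.initRow w)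

/-- The computation on the input word `w` reaches a halting letter at the origin. -/
def Halts (R : CellRule A) (w : List A) : Prop := ∃ t, R.row w t 0 ∈ R.halted

theorem row_succ (R : CellRule A) (w : List A) (t : ℕ) :
    R.row w (t + 1) = R.next (R.row w t) :=
  Function.iterate_succ_apply' _ _ _

/-- The letters of `K` are closed under the rule. -/
structure Preserves (R : CellRule A) (K : Set A) : Prop where
  blank_mem : R.blank ∈ K
  boundary_mem : ∀ {a b}, a ∈ K → b ∈ K → R.boundary a b ∈ K
  interior_mem : ∀ {o a b c}, o ∈ K → a ∈ K → b ∈ K → c ∈ K → R.interior o a b c ∈ K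

theorem Preserves.next_mem {R : CellRule A} {K : Set A} (h : R.Preserves K) {r : ℕ → A}
    (hr : ∀ p, r p ∈ K) : ∀ p, R.next r p ∈ K
  | 0 => h.boundary_mem (hr _) (hr _)
  | _ + 1 => h.interior_mem (hr _) (hr _) (hr _) (hr _)

theorem Preserves.row_mem {R : CellRule A} {K : Set A} (h : R.Preserves K) {w : List A}
    (hw : ∀ a ∈ w, a ∈ K) (t p : ℕ) : R.row w t p ∈ K := by
  induction t generalizing p with
  | zero =>
    change w.getD p R.blank ∈ K
    rcases lt_or_ge p w.length with hp | hp
    · rw [List.getD_eq_getElem _ _ hp]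
      exact hw _ (List.getElem_mem hp)
    · rw [List.getD_eq_default _ _ hp]
      exact h.blank_mem
  | succ t ih =>
    rw [row_succ]
    exact h.next_mem ih p

/-- Transport of a rule along an encoding of its letters. -/
def map (R : CellRule A) (enc : A → B) (dec : B → A) : CellRule B where
  boundary a b := enc (R.boundary (dec a) (dec b))
  interior o a b c := enc (R.interior (dec o) (dec a) (dec b) (dec c))
  blank := enc R.blank
  halted := dec ⁻¹' R.halted

theorem row_map {R : CellRule A} {K : Set A} (h : R.Preserves K) {enc : A → B} {dec : B → A}
    (hdec : Set.LeftInvOn dec enc K) {w : List A} (hw : ∀ a ∈ w, a ∈ K) (t : ℕ) :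
    (R.map enc dec).row (w.map enc) t = enc ∘ R.row w t := by
  induction t with
  | zero => funext p; exact List.getD_map _ _ _
  | succ t ih =>
    have hrow (p : ℕ) : dec (enc (R.row w t p)) = R.row w t p := hdec (h.row_mem hw t p)
    rw [row_succ, ih, row_succ]
    funext p
    cases p <;> simp only [next, map, Function.comp_apply, hrow]

theorem halts_map_iff {R : CellRule A} {K : Set A} (h : R.Preserves K) {enc : A → B}
    {dec : B → A} (hdec : Set.LeftInvOn dec enc K) {w : List A} (hw : ∀ a ∈ w, a ∈ K) :
    (R.map enc dec).Halts (w.map enc) ↔ R.Halts w := by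
  refine exists_congr fun t => ?_
  rw [row_map h hdec hw]
  exact iff_of_eq (congrArg (· ∈ R.halted) (hdec (h.row_mem hw t 0)))

end CellRule

theorem eval_ite_dom_iff {σ : Type*} (p : σ → Prop) [DecidablePred p] (g : σ → σ) (a : σ) :
    (StateTransition.eval (fun s => if p s then none else some (g s)) a).Dom ↔
      ∃ t, p (g^[t] a) := by
  set f : σ → Option σ := fun s => if p s then none else some (g s) with hf
  constructor
  · intro h
    obtain ⟨hreach, hlast⟩ := StateTransition.mem_eval.1 (Part.get_mem h)
    clear_value f
    generalize (StateTransition.eval f a).get h = b at hreach hlast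
    clear h
    induction hreach using Relation.ReflTransGen.head_induction_on with
    | refl => exact ⟨0, by simpa [hf] using hlast⟩
    | head hstep _ ih =>
      obtain ⟨t, ht⟩ := ih
      have hg := (Option.ite_none_left_eq_some.1 (hf ▸ hstep)).2
      exact ⟨t + 1, by rwa [Function.iterate_succ_apply, Option.some.inj hg]⟩
  · rintro ⟨t, ht⟩
    induction t generalizing a with
    | zero => exact Part.dom_iff_mem.2 ⟨a, StateTransition.mem_eval.2 ⟨.refl, if_pos ht⟩⟩
    | succ t ih =>
      by_cases hp : p a
      · exact Part.dom_iff_mem.2 ⟨a, StateTransition.mem_eval.2 ⟨.refl, if_pos hp⟩⟩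
      · have hstep : g a ∈ f a := if_neg hp
        rw [StateTransition.reaches_eval (.single hstep)]
        exact ih _ ht

section OfTM0

open Turing

variable {Γ Λ : Type*} [Inhabited Γ] [Inhabited Λ]

/-- The configuration `c` as a row of letters: the tape is folded at the head, and the letter at
position `p` holds the state and the symbols at distance `p` to the right of the head and at
distance `p + 1` to its left. -/
def foldedRow (c : TM0.Cfg Γ Λ) (p : ℕ) : Λ × Γ × Γ :=
  (c.q, c.Tape.nth p, c.Tape.nth (-(p + 1)))

/-- The next letter of the cell `c` of a folded tape with head cell `o` and neighbours `l` and `r`.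
The tape moves under the head, so a move shifts the two halves in opposite directions. -/
def foldedStep (M : TM0.Machine Γ Λ) (isOrigin : Bool) (o l c r : Λ × Γ × Γ) : Λ × Γ × Γ :=
  match M o.1 o.2.1 with
  | none => c
  | some (q, .move .right) => (q, r.2.1, l.2.2)
  | some (q, .move .left) => (q, l.2.1, r.2.2)
  | some (q, .write a) => (q, bif isOrigin then a else c.2.1, c.2.2)

/-- The rule that simulates a Turing machine on folded tapes. Since the tape is folded between the
head and the cell to its left, the left neighbour of the origin is its own mirror image. -/
def CellRule.ofTM0 (M : TM0.Machine Γ Λ) : CellRule (Λ × Γ × Γ) where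
  boundary o r := foldedStep M true o (o.1, o.2.2, o.2.1) o r
  interior o l c r := foldedStep M false o l c r
  blank := default
  halted := {o | M o.1 o.2.1 = none}

theorem foldedStep_foldedRow (M : TM0.Machine Γ Λ) {c c' : TM0.Cfg Γ Λ}
    (h : TM0.step M c = some c') (q : Λ) (p : ℕ) :
    foldedStep M (decide (p = 0)) (foldedRow c 0) (q, c.Tape.nth (p - 1), c.Tape.nth (-p))
      (foldedRow c p) (foldedRow c (p + 1)) = foldedRow c' p := by
  obtain ⟨q, T⟩ := c
  obtain ⟨⟨q', s⟩, hM, rfl⟩ := Option.map_eq_some_iff.1 h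
  have nth_head : T.nth ((0 : ℕ) : ℤ) = T.head := rfl
  simp only [foldedRow, foldedStep, nth_head, hM]
  rcases s with (_ | _) | a
  · simp only [Tape.move_left_nth, Nat.cast_add, Nat.cast_one]
    congr 3
  · simp only [Tape.move_right_nth, Nat.cast_add, Nat.cast_one]
    congr 3
    ring
  · have left_ne_zero : -((p : ℤ) + 1) ≠ 0 := by omega
    simp only [Tape.write_nth, left_ne_zero, if_false, Nat.cast_eq_zero, Bool.cond_decide]

theorem next_foldedRow (M : TM0.Machine Γ Λ) {c c' : TM0.Cfg Γ Λ} (h : TM0.step M c = some c') :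
    (CellRule.ofTM0 M).next (foldedRow c) = foldedRow c' := by
  funext p
  cases p with
  | zero => exact foldedStep_foldedRow M h _ 0
  | succ p =>
    rw [← foldedStep_foldedRow M h c.q (p + 1)]
    simp only [CellRule.next, CellRule.ofTM0, foldedRow, Nat.cast_add, Nat.cast_one,
      add_sub_cancel_right]
    rfl

theorem foldedRow_zero_mem_halted_iff (M : TM0.Machine Γ Λ) (c : TM0.Cfg Γ Λ) :
    foldedRow c 0 ∈ (CellRule.ofTM0 M).halted ↔ TM0.step M c = none :=
  (Option.map_eq_none_iff (f := fun _ : Λ × TM0.Stmt Γ => _)).symm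

theorem foldedRow_init (M : TM0.Machine Γ Λ) (w : List Γ) :
    foldedRow (TM0.init w) = (CellRule.ofTM0 M).initRow (w.map fun a => (default, a, default)) := by
  have nth_right (p : ℕ) : (Tape.mk₁ w).nth p = w.getD p default := by
    rw [Tape.mk₁, Tape.mk₂, Tape.mk'_nth_nat, ListBlank.nth_mk]
    rfl
  have nth_left (p : ℕ) : (Tape.mk₁ w).nth (-(p + 1)) = default := by
    rw [← Int.negSucc_eq]
    exact ListBlank.nth_mk [] p
  funext p
  have foldedRow_eq : foldedRow (TM0.init (Λ := Λ) w) p = (default, w.getD p default, default) :=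
    Prod.ext rfl (Prod.ext (nth_right p) (nth_left p))
  rw [foldedRow_eq]
  exact (List.getD_map w default fun a => ((default, a, default) : Λ × Γ × Γ)).symm

theorem CellRule.halts_ofTM0_iff (M : TM0.Machine Γ Λ) (w : List Γ) :
    (CellRule.ofTM0 M).Halts (w.map fun a => (default, a, default)) ↔ (TM0.eval M w).Dom := by
  classical
  set R := CellRule.ofTM0 M
  have respects : StateTransition.Respects (TM0.step M)
      (fun r => if r 0 ∈ R.halted then none else some (R.next r)) fun c r => foldedRow c = r := by
    refine StateTransition.fun_respects.2 fun c => ?_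
    cases h : TM0.step M c with
    | none => exact if_pos ((foldedRow_zero_mem_halted_iff M c).2 h)
    | some c' =>
      have not_halted : foldedRow c 0 ∉ R.halted := by
        rw [foldedRow_zero_mem_halted_iff, h]
        exact Option.some_ne_none c'
      exact .single ((if_neg not_halted).trans (congrArg some (next_foldedRow M h)))
  calc R.Halts _ ↔ _ := (eval_ite_dom_iff (fun r : ℕ → _ => r 0 ∈ R.halted) R.next _).symm
    _ ↔ (StateTransition.eval (TM0.step M) (TM0.init w)).Dom :=
      StateTransition.tr_eval_dom respects (foldedRow_init M w)
    _ ↔ (TM0.eval M w).Dom := Iff.rfl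

theorem CellRule.preserves_ofTM0 {M : TM0.Machine Γ Λ} {S : Set Λ} (hS : TM0.Supports M S) :
    (CellRule.ofTM0 M).Preserves {a | a.1 ∈ S} := by
  have foldedStep_mem (b : Bool) {o c : Λ × Γ × Γ} (l r : Λ × Γ × Γ) (ho : o.1 ∈ S)
      (hc : c.1 ∈ S) : (foldedStep M b o l c r).1 ∈ S := by
    unfold foldedStep
    split
    · exact hc
    all_goals rename_i h; exact hS.2 h ho
  exact ⟨hS.1, fun ho _ => foldedStep_mem _ _ _ ho ho, fun ho _ hc _ => foldedStep_mem _ _ _ ho hc⟩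

end OfTM0

theorem exists_injOn_outLetter {A : Type*} {K : Set A} (hK : K.Finite) :
    ∃ (n : ℕ) (enc : A → OutLetter n), Set.InjOn enc K := by
  classical
  have := hK.to_subtype
  obtain ⟨n, ⟨e⟩⟩ := Finite.exists_equiv_fin K
  refine ⟨n, fun a i => decide ((e.symm i : A) = a), fun a ha b _ hab => ?_⟩
  simpa using (congrFun hab (e ⟨a, ha⟩)).symm

theorem primrec_cons_reverse_map_bits {β : Type*} [Primcodable β] (x : β) (g : Bool → β) :
    Primrec fun e : ℕ => x :: (e.bits.map g).reverse :=
  Primrec.list_cons.comp (Primrec.const x) (Primrec.list_reverse.comp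
    (Primrec.list_map primrec_bits ((Primrec.dom_finite g).comp Primrec.snd).to₂))

theorem exists_cellRule_not_rePred :
    ∃ (n : ℕ) (R : CellRule (OutLetter n)), ¬ REPred fun w => ¬ R.Halts w := by
  obtain ⟨Γ, Λ, _, _, _, M, S, x, g, hS, hM, hre⟩ := exists_tm0_not_rePred
  let K : Set (Λ × Γ × Γ) := {a | a.1 ∈ S}
  have hK : K.Finite := (hS.prod Set.finite_univ).subset fun a ha => ⟨ha, trivial⟩
  obtain ⟨n, enc, henc⟩ := exists_injOn_outLetter hK
  let cell (a : Γ) : Λ × Γ × Γ := (default, a, default)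
  have cell_mem (w : List Γ) : ∀ a ∈ w.map cell, a ∈ K :=
    List.forall_mem_map.2 fun _ _ => hM.1
  have primrec_word := primrec_cons_reverse_map_bits (enc (cell x)) fun b => enc (cell (g b))
  refine ⟨n, (CellRule.ofTM0 M).map enc (Function.invFunOn enc K), fun h => hre ?_⟩
  refine (rePred_comp h primrec_word.to_comp).of_eq fun e => not_congr ?_
  rw [← CellRule.halts_ofTM0_iff, ← CellRule.halts_map_iff (CellRule.preserves_ofTM0 hM)
    henc.leftInvOn_invFunOn (cell_mem _)]
  simp only [List.map_cons, List.map_reverse, List.map_map]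
  rfl

namespace CellRule

variable {A : Type*}

theorem next_congr (R : CellRule A) {r r' : ℕ → A} {p : ℕ} (h : ∀ q ≤ p + 1, r q = r' q) :
    R.next r p = R.next r' p := by
  cases p with
  | zero => simp only [next, h 0 (by omega), h 1 (by omega)]
  | succ p =>
    simp only [next, h 0 (by omega), h p (by omega), h (p + 1) (by omega), h (p + 2) le_rfl]

/-- The rule applied to a finite initial segment of a row. The last cell is dropped, since its right
neighbour is unknown. -/
def nextList (R : CellRule A) (l : List A) : List A :=
  (List.range (l.length - 1)).map (R.next (R.initRow l))

theorem initRow_map_range (R : CellRule A) (r : ℕ → A) {N p : ℕ} (hp : p < N) :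
    R.initRow ((List.range N).map r) p = r p := by
  rw [initRow, List.getD_eq_getElem _ _ (by simpa using hp), List.getElem_map, List.getElem_range]

theorem nextList_map_range (R : CellRule A) (r : ℕ → A) (N : ℕ) :
    R.nextList ((List.range (N + 1)).map r) = (List.range N).map (R.next r) := by
  rw [nextList, List.length_map, List.length_range, Nat.add_sub_cancel]
  refine List.map_congr_left fun p hp => R.next_congr fun q hq => R.initRow_map_range r ?_
  have := List.mem_range.1 hp
  omega

theorem iterate_nextList (R : CellRule A) (r : ℕ → A) (t N : ℕ) :
    R.nextList^[t] ((List.range (N + t)).map r) = (List.range N).map (R.next^[t] r) := by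
  induction t generalizing N r with
  | zero => rfl
  | succ t ih =>
    rw [Function.iterate_succ_apply, ← add_assoc, nextList_map_range, ih,
      Function.iterate_succ_apply]

variable [Primcodable A]

theorem primrec_initRow (R : CellRule A) : Primrec₂ R.initRow :=
  Primrec.list_getD R.blank

variable [Finite A]

theorem primrec_next_initRow (R : CellRule A) : Primrec₂ fun l => R.next (R.initRow l) := by
  have boundary_primrec : Primrec fun x : A × A => R.boundary x.1 x.2 := Primrec.dom_finite _
  have interior_primrec : Primrec fun x : A × A × A × A =>
      R.interior x.1 x.2.1 x.2.2.1 x.2.2.2 := Primrec.dom_finite _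
  have cell_primrec {α : Type _} [Primcodable α] {l : α → List A} {i : α → ℕ} (hl : Primrec l)
      (hi : Primrec i) : Primrec fun x => R.initRow (l x) (i x) := R.primrec_initRow.comp hl hi
  have origin : Primrec fun x : List A × ℕ =>
      R.boundary (R.initRow x.1 0) (R.initRow x.1 1) :=
    boundary_primrec.comp
      ((cell_primrec .fst (.const 0)).pair (cell_primrec .fst (.const 1)))
  have successor : Primrec₂ fun (x : List A × ℕ) (p : ℕ) => R.interior (R.initRow x.1 0)
      (R.initRow x.1 p) (R.initRow x.1 (p + 1)) (R.initRow x.1 (p + 2)) := by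
    have row : Primrec fun x : (List A × ℕ) × ℕ => x.1.1 := Primrec.fst.comp .fst
    exact interior_primrec.comp ((cell_primrec row (.const 0)).pair ((cell_primrec row .snd).pair
      ((cell_primrec row (Primrec.succ.comp .snd)).pair
        (cell_primrec row (Primrec.succ.comp (Primrec.succ.comp .snd))))))
  exact (Primrec.nat_casesOn .snd origin successor).of_eq fun ⟨l, p⟩ => by cases p <;> rfl

theorem primrec_nextList (R : CellRule A) : Primrec R.nextList :=
  Primrec.list_map (Primrec.list_range.comp (Primrec.nat_sub.comp Primrec.list_length (.const 1)))
    R.primrec_next_initRow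

theorem primrec_row (R : CellRule A) (w : List A) : Primrec₂ (R.row w) := by
  have segment_primrec : Primrec fun x : ℕ × ℕ =>
      (List.range (x.2 + 1 + x.1)).map (R.initRow w) :=
    Primrec.list_map (Primrec.list_range.comp
      (Primrec.nat_add.comp (Primrec.succ.comp .snd) .fst))
      (R.primrec_initRow.comp (.const w) .snd)
  have row_primrec : Primrec fun x : ℕ × ℕ => R.initRow
      (R.nextList^[x.1] ((List.range (x.2 + 1 + x.1)).map (R.initRow w))) x.2 :=
    R.primrec_initRow.comp
      (Primrec.nat_iterate .fst segment_primrec (R.primrec_nextList.comp .snd)) .snd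
  refine row_primrec.of_eq fun ⟨t, p⟩ => ?_
  simp only [iterate_nextList]
  exact R.initRow_map_range _ (Nat.lt_succ_self p)

end CellRule

/-! ## Runs and enforcement -/

/-- The inputs of a trace. -/
def InfWord.inputs {m n : ℕ} (a : InfWord (Letter m n)) : InfWord (InLetter m) :=
  fun j => (a j).1

section InfiniteWords

variable {A B : Type} {m n : ℕ}

theorem InfWord.length_first (w : InfWord A) (k : ℕ) : (w.first k).length = k := by
  simp only [InfWord.first, List.length_map, List.length_range]

theorem InfWord.getElem_first (w : InfWord A) {j k : ℕ} (h : j < (w.first k).length) :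
    (w.first k)[j] = w j := by
  simp only [InfWord.first, List.getElem_map, List.getElem_range]

theorem InfWord.take_first (w : InfWord A) {j k : ℕ} (h : j ≤ k) :
    (w.first k).take j = w.first j := by
  rw [InfWord.first, ← List.map_take, List.take_range, min_eq_left h, InfWord.first]

theorem InfWord.first_prefix_first (w : InfWord A) {j k : ℕ} (h : j ≤ k) :
    w.first j <+: w.first k :=
  w.take_first h ▸ List.take_prefix j _

theorem InfWord.first_prepend (u : List A) (w : InfWord A) :
    (InfWord.prepend u w).first u.length = u :=
  List.ext_getElem (InfWord.length_first _ _) fun i _ hi => by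
    simp [InfWord.getElem_first, InfWord.prepend, hi]

theorem InfWord.exists_first_eq [Nonempty A] (u : List A) : ∃ w k, InfWord.first w k = u :=
  ‹Nonempty A›.elim fun a => ⟨_, _, InfWord.first_prepend u fun _ => a⟩

theorem InfWord.map_fst_first (a : InfWord (Letter m n)) (k : ℕ) :
    (a.first k).map Prod.fst = a.inputs.first k :=
  List.map_map

end InfiniteWords

section Runs

variable {m n : ℕ}

theorem SeqSystem.run_snd_first (S : SeqSystem m n) (V : List (InfWord (InLetter m)))
    (v : InfWord (InLetter m)) (k : ℕ) :
    (S.run (V, v.first k)).2 = (respond (S V) v).first k := by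
  refine List.ext_getElem (by simp [SeqSystem.run, InfWord.length_first]) fun i hi hi' => ?_
  have hik : i ≤ k := (InfWord.length_first _ k ▸ hi').le
  simp only [SeqSystem.run, List.getElem_ofFn, InfWord.take_first _ hik, InfWord.getElem_first,
    respond, Fin.getElem_fin]

theorem SeqSystem.map_inputs_run (S : SeqSystem m n) (p : SeqPrefix (InLetter m)) :
    (S.run p).1.map InfWord.inputs = p.1 :=
  List.ext_getElem (by simp [SeqSystem.run]) fun i _ _ => by
    simp only [SeqSystem.run, List.getElem_map, List.getElem_ofFn]
    rfl

theorem SeqSystem.map_fst_run (S : SeqSystem m n) (p : SeqPrefix (InLetter m)) :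
    (S.run p).2.map Prod.fst = p.2 :=
  List.ext_getElem (by simp [SeqSystem.run]) fun i _ _ => by simp [SeqSystem.run]

theorem SeqSystem.run_const_fst (s : List (InLetter m) → OutLetter n)
    (p : SeqPrefix (InLetter m)) : (SeqSystem.run (fun _ => s) p).1 = p.1.map (respond s) :=
  List.ext_getElem (by simp [SeqSystem.run]) fun i _ _ => by simp [SeqSystem.run]

theorem SeqSystem.run_const_le_run_const (s : List (InLetter m) → OutLetter n)
    {p q : SeqPrefix (InLetter m)} (h : p.Le q) :
    (SeqSystem.run (fun _ => s) p).Le (SeqSystem.run (fun _ => s) q) := by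
  obtain ⟨U, u⟩ := p
  obtain ⟨V, v⟩ := q
  obtain ⟨rfl, hu⟩ | ⟨w, W, rfl, hu⟩ := h
  · obtain ⟨w, k, rfl⟩ := InfWord.exists_first_eq v
    have hk : u.length ≤ k := InfWord.length_first w k ▸ hu.length_le
    have hu : u = w.first u.length := (w.take_first hk).symm ▸ List.prefix_iff_eq_take.1 hu
    rw [hu]
    exact .inl ⟨rfl, by simpa only [SeqSystem.run_snd_first] using InfWord.first_prefix_first _ hk⟩
  · refine .inr ⟨respond s w, W.map (respond s), ?_, ?_⟩
    · simp only [SeqSystem.run_const_fst, List.map_append, List.map_cons]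
    · rw [show u = w.first u.length from hu, SeqSystem.run_snd_first, InfWord.length_first]

end Runs

section Enforceability

variable {m n : ℕ} {H : Hyperproperty m n} {s : List (InLetter m) → OutLetter n}
  {V : ℕ → InfWord (InLetter m)}

theorem Enforceable.exists_mem_forall_exists_inputs_eq (h : Enforceable H)
    (V : ℕ → InfWord (InLetter m)) : ∃ T ∈ H, ∀ k, ∃ a ∈ T, a.inputs = V k := by
  obtain ⟨enf, -, hsound, -⟩ := h
  exact ⟨_, hsound (fun _ _ _ => false) V, fun k => ⟨_, ⟨k, rfl⟩, rfl⟩⟩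

theorem SeqPrefix.Winning.exists_mem {p : SeqPrefix (Letter m n)} (h : p.Winning H)
    (V : ℕ → InfWord (InLetter m)) :
    ∃ T ∈ H, (∀ a ∈ p.1, a ∈ T) ∧ (∃ w, InfWord.prepend p.2 w ∈ T) ∧
      ∀ k, ∃ a ∈ T, a.inputs = V k := by
  obtain ⟨σ, hσ⟩ := h
  refine ⟨_, not_not.1 (not_exists.1 hσ fun k => V (k - 1)), fun a ha => ⟨0, ?_⟩,
    ⟨_, 0, List.mem_append_right _ (List.mem_singleton_self _)⟩,
    fun k => ⟨_, ⟨k + 1, List.mem_append_right _ (List.mem_singleton_self _)⟩, rfl⟩⟩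
  exact List.mem_append_left _ ha

theorem run_eq_run_const_of_winning
    (hforced : ∀ T ∈ H, (∀ k, ∃ a ∈ T, a.inputs = V k) → ∀ a ∈ T, a = respond s a.inputs)
    {S : SeqSystem m n} {p : SeqPrefix (InLetter m)} (hp : (S.run p).Winning H) :
    S.run p = SeqSystem.run (fun _ => s) p := by
  obtain ⟨T, hTH, hfst, ⟨w, hw⟩, hV⟩ := hp.exists_mem V
  have hT := hforced T hTH hV
  refine Prod.ext ?_ ?_
  · calc (S.run p).1 = (S.run p).1.map fun a => respond s a.inputs :=
          (List.map_id _).symm.trans (List.map_congr_left fun a h => hT a (hfst a h))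
      _ = (SeqSystem.run (fun _ => s) p).1 := by
        rw [SeqSystem.run_const_fst, ← S.map_inputs_run p, List.map_map]
        rfl
  · set a := InfWord.prepend (S.run p).2 w
    have hrun : (S.run p).2 = a.first (S.run p).2.length := (InfWord.first_prepend _ w).symm
    have hinputs : p.2 = a.inputs.first (S.run p).2.length := by
      rw [← InfWord.map_fst_first, ← hrun, S.map_fst_run]
    calc (S.run p).2 = (respond s a.inputs).first (S.run p).2.length := by rw [← hT a hw, ← hrun]
      _ = (SeqSystem.run (fun _ => s) p).2 := by
        rw [← SeqSystem.run_snd_first (fun _ => s) p.1, ← hinputs]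

theorem isEnforcementMechanism_const (hs : Computable s) :
    IsEnforcementMechanism fun (_ : SeqSystem m n) _ => s := by
  refine ⟨fun x => some (s (x.2.2.1.map Prod.fst)), ?_, fun S V v => ?_⟩
  · have hinputs : Primrec fun u : List (Letter m n) => u.map Prod.fst :=
      Primrec.list_map .id (Primrec.fst.comp .snd).to₂
    exact Computable.option_some.comp (hs.comp (hinputs.to_comp.comp
      (Computable.fst.comp (Computable.snd.comp .snd))))
  · simp only [SeqSystem.map_fst_run, Option.some.injEq]
    exact ⟨⟨0, trivial⟩, fun _ _ => Eq.symm⟩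

theorem enforceable_of_forall_eq_respond (hs : Computable s)
    (hmem : ∀ W : ℕ → InfWord (InLetter m), (Set.range fun k => respond s (W k)) ∈ H)
    (hforced : ∀ T ∈ H, (∀ k, ∃ a ∈ T, a.inputs = V k) → ∀ a ∈ T, a = respond s a.inputs) :
    Enforceable H :=
  ⟨fun _ _ => s, isEnforcementMechanism_const hs, fun _ => hmem, fun _ _ _ hp hle =>
    run_eq_run_const_of_winning hforced hp ▸ SeqSystem.run_const_le_run_const s hle⟩

end Enforceability

/-! ## Uniform definability in quantifier-free formulas -/

theorem InfWord.suffix_zero {A : Type} (w : InfWord A) : w.suffix 0 = w :=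
  funext fun j => congrArg w (zero_add j)

theorem InfWord.suffix_suffix {A : Type} (w : InfWord A) (i j : ℕ) :
    (w.suffix i).suffix j = w.suffix (i + j) :=
  funext fun k => congrArg w (add_assoc i j k).symm

theorem primrec_mul_add {α : Type*} [Primcodable α] (k r : ℕ) {f : α → ℕ} (hf : Primrec f) :
    Primrec fun a => k * f a + r :=
  Primrec.nat_add.comp (Primrec.nat_mul.comp (.const k) hf) (.const r)

/-- The predicates `P a` on trace assignments are definable by quantifier-free formulas with trace
variables in `X` whose codes are computed primitive recursively from `a`. -/
def UniformlyExpressible {α : Type*} [Primcodable α] {m n : ℕ} (X : Set ℕ)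
    (P : α → (ℕ → InfWord (Letter m n)) → Prop) : Prop :=
  ∃ ψ : α → HyperBody (Fin m ⊕ Fin n), (Primrec fun a => (ψ a).code) ∧
    (∀ a, (ψ a).vars ⊆ X) ∧ ∀ a A, (ψ a).Sat A ↔ P a A

namespace UniformlyExpressible

section Connectives

variable {α : Type*} [Primcodable α] {m n : ℕ} {X : Set ℕ}
  {P Q : α → (ℕ → InfWord (Letter m n)) → Prop}

theorem of_iff (h : UniformlyExpressible X P) (hPQ : ∀ a A, P a A ↔ Q a A) :
    UniformlyExpressible X Q :=
  (funext₂ fun a A => propext (hPQ a A) : P = Q) ▸ h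

theorem of_finite [Finite α] (h : ∀ a, UniformlyExpressible X fun _ : Unit => P a) :
    UniformlyExpressible X P := by
  choose p _ hvars hp using h
  exact ⟨fun a => p a (), Primrec.dom_finite _, fun a => hvars a (), fun a => hp a ()⟩

theorem atom (q : Fin m ⊕ Fin n) {x : ℕ} (hx : x ∈ X) :
    UniformlyExpressible X fun (_ : α) (A : ℕ → InfWord (Letter m n)) => (A x 0).Has q :=
  ⟨fun _ => .atom q x, .const _, fun _ => Set.singleton_subset_iff.2 hx, fun _ _ => Iff.rfl⟩

theorem not (h : UniformlyExpressible X P) : UniformlyExpressible X fun a A => ¬ P a A := by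
  obtain ⟨p, hcode, hvars, hp⟩ := h
  exact ⟨fun a => .neg (p a), primrec_mul_add 5 1 hcode, hvars, fun a A => not_congr (hp a A)⟩

theorem or (hP : UniformlyExpressible X P) (hQ : UniformlyExpressible X Q) :
    UniformlyExpressible X fun a A => P a A ∨ Q a A := by
  obtain ⟨p, hpcode, hpvars, hp⟩ := hP
  obtain ⟨q, hqcode, hqvars, hq⟩ := hQ
  exact ⟨fun a => .or (p a) (q a), primrec_mul_add 5 2 (Primrec₂.natPair.comp hpcode hqcode),
    fun a => Set.union_subset (hpvars a) (hqvars a), fun a A => or_congr (hp a A) (hq a A)⟩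

theorem and (hP : UniformlyExpressible X P) (hQ : UniformlyExpressible X Q) :
    UniformlyExpressible X fun a A => P a A ∧ Q a A :=
  (hP.not.or hQ.not).not.of_iff fun a A => by tauto

theorem imp (hP : UniformlyExpressible X P) (hQ : UniformlyExpressible X Q) :
    UniformlyExpressible X fun a A => P a A → Q a A :=
  (hP.not.or hQ).of_iff fun a A => by tauto

theorem next (h : UniformlyExpressible X P) :
    UniformlyExpressible X fun a A => P a fun x => (A x).suffix 1 := by
  obtain ⟨p, hcode, hvars, hp⟩ := h
  exact ⟨fun a => .next (p a), primrec_mul_add 5 3 hcode, hvars, fun a A => hp a _⟩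

theorem suffix (h : UniformlyExpressible X P) (k : ℕ) :
    UniformlyExpressible X fun a A => P a fun x => (A x).suffix k := by
  induction k with
  | zero => exact h.of_iff fun a A => by simp only [InfWord.suffix_zero]
  | succ k ih => exact ih.next.of_iff fun a A => by simp only [InfWord.suffix_suffix, add_comm 1]

theorem untl (hP : UniformlyExpressible X P) (hQ : UniformlyExpressible X Q) :
    UniformlyExpressible X fun a A => ∃ i, Q a (fun x => (A x).suffix i) ∧
      ∀ j < i, P a fun x => (A x).suffix j := by
  obtain ⟨p, hpcode, hpvars, hp⟩ := hP
  obtain ⟨q, hqcode, hqvars, hq⟩ := hQ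
  refine ⟨fun a => .untl (p a) (q a), primrec_mul_add 5 4 (Primrec₂.natPair.comp hpcode hqcode),
    fun a => Set.union_subset (hpvars a) (hqvars a), fun a A => ?_⟩
  simp only [HyperBody.Sat, hp, hq]

theorem forall_of_forall_lt (hP : UniformlyExpressible X P) (hQ : UniformlyExpressible X Q) :
    UniformlyExpressible X fun a A => ∀ i, (∀ j < i, P a fun x => (A x).suffix j) →
      Q a fun x => (A x).suffix i :=
  (hP.untl hQ.not).not.of_iff fun a A => by grind

theorem input_eq (i : Fin m) {x : ℕ} (hx : x ∈ X) (k : ℕ) (b : Bool) :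
    UniformlyExpressible X fun (_ : α) (A : ℕ → InfWord (Letter m n)) => (A x k).1 i = b := by
  have h := (atom (α := α) (n := n) (Sum.inl i) hx).suffix k
  cases b
  · exact h.not.of_iff fun _ A => by simp [InfWord.suffix, Letter.Has]
  · exact h

theorem output_apply_eq (o : Fin n) {x : ℕ} (hx : x ∈ X) (k : ℕ) (b : Bool) :
    UniformlyExpressible X fun (_ : α) (A : ℕ → InfWord (Letter m n)) => (A x k).2 o = b := by
  have h := (atom (α := α) (m := m) (Sum.inr o) hx).suffix k
  cases b
  · exact h.not.of_iff fun _ A => by simp [InfWord.suffix, Letter.Has]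
  · exact h

theorem forall_getElem {Q : (ℕ → InfWord (Letter m n)) → Prop}
    (hP : UniformlyExpressible X P) (hQ : UniformlyExpressible X fun _ : Unit => Q) :
    UniformlyExpressible X fun (w : List α) A =>
      (∀ i (h : i < w.length), P w[i] fun x => (A x).suffix i) ∧
        Q fun x => (A x).suffix w.length := by
  obtain ⟨p, hpcode, hpvars, hp⟩ := hP
  obtain ⟨q, -, hqvars, hq⟩ := hQ
  let conj (c : α) (r : HyperBody (Fin m ⊕ Fin n)) : HyperBody (Fin m ⊕ Fin n) :=
    .neg (.or (.neg (p c)) (.neg (.next r)))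
  refine ⟨fun w => w.foldr conj (q ()), ?_, fun w => ?_, fun w => ?_⟩
  · refine (Primrec.list_foldr (h := fun (_ : List α) (s : α × ℕ) =>
      5 * (5 * Nat.pair (5 * (p s.1).code + 1) (5 * (5 * s.2 + 3) + 1) + 2) + 1)
      .id (.const (q ()).code) ?_).of_eq fun w => ?_
    · exact primrec_mul_add 5 1 (primrec_mul_add 5 2 (Primrec₂.natPair.comp
        (primrec_mul_add 5 1 (hpcode.comp (Primrec.fst.comp .snd)))
        (primrec_mul_add 5 1 (primrec_mul_add 5 3 (Primrec.snd.comp .snd)))))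
    · exact List.foldr_hom HyperBody.code fun _ _ => rfl
  · induction w with
    | nil => exact hqvars ()
    | cons c w ih => exact Set.union_subset (hpvars c) ih
  · induction w with
    | nil => exact fun A => by simp [hq, InfWord.suffix_zero]
    | cons c w ih =>
      intro A
      have hconj : (conj c (w.foldr conj (q ()))).Sat A ↔
          P c A ∧ (w.foldr conj (q ())).Sat fun x => (A x).suffix 1 := by
        simp only [conj, HyperBody.Sat, hp, not_or, not_not]
      refine (hconj.trans (and_congr_right' (ih _))).trans ?_
      simp only [InfWord.suffix_suffix, List.length_cons, add_comm 1, ← and_assoc,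
        Nat.forall_lt_succ_left', List.getElem_cons_zero, List.getElem_cons_succ,
        InfWord.suffix_zero]

end Connectives

section Conjunctions

variable {α : Type*} [Primcodable α] {m n : ℕ} [Nonempty (Fin m ⊕ Fin n)]
  {X : Set ℕ} [Nonempty X] {P : α → (ℕ → InfWord (Letter m n)) → Prop}

theorem const_true : UniformlyExpressible X fun (_ : α) (_ : ℕ → InfWord (Letter m n)) => True := by
  obtain ⟨q⟩ := ‹Nonempty (Fin m ⊕ Fin n)›
  obtain ⟨x, hx⟩ := ‹Nonempty X›
  exact ((atom q hx).imp (atom q hx)).of_iff fun _ A => iff_of_true id trivial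

theorem forall_finite {ι : Type*} [Finite ι] {P : ι → α → (ℕ → InfWord (Letter m n)) → Prop}
    (h : ∀ i, UniformlyExpressible X (P i)) : UniformlyExpressible X fun a A => ∀ i, P i a A := by
  have := Fintype.ofFinite ι
  suffices ∀ s : Finset ι, UniformlyExpressible X fun a A => ∀ i ∈ s, P i a A from
    (this Finset.univ).of_iff fun a A => by simp
  intro s
  induction s using Finset.cons_induction with
  | empty => exact const_true.of_iff fun a A => by simp
  | cons i s hi ih => exact ((h i).and ih).of_iff fun a A => by simp

theorem always (h : UniformlyExpressible X P) :
    UniformlyExpressible X fun a A => ∀ i, P a fun x => (A x).suffix i :=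
  (const_true.forall_of_forall_lt h).of_iff fun a A => by simp

theorem output_eq {x : ℕ} (hx : x ∈ X) (k : ℕ) (c : OutLetter n) :
    UniformlyExpressible X fun (_ : α) (A : ℕ → InfWord (Letter m n)) => (A x k).2 = c :=
  (forall_finite fun o => output_apply_eq o hx k (c o)).of_iff fun _ _ => funext_iff.symm

theorem outputs_eq_getD {x : ℕ} (hx : x ∈ X) (d : OutLetter n) :
    UniformlyExpressible X fun (w : List (OutLetter n)) (A : ℕ → InfWord (Letter m n)) =>
      ∀ i, (A x i).2 = w.getD i d := by
  refine (forall_getElem (of_finite fun c => output_eq hx 0 c) (output_eq hx 0 d).always).of_iff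
    fun w A => ?_
  simp only [InfWord.suffix, add_zero]
  constructor
  · rintro ⟨hw, hd⟩ i
    rcases lt_or_ge i w.length with hi | hi
    · rw [hw i hi, List.getD_eq_getElem _ _ hi]
    · obtain ⟨j, rfl⟩ := Nat.exists_eq_add_of_le hi
      rw [hd j, List.getD_eq_default _ _ hi]
  · exact fun h => ⟨fun i hi => by rw [h, List.getD_eq_getElem _ _ hi],
      fun i => by rw [h, List.getD_eq_default _ _ (Nat.le_add_right _ i)]⟩

end Conjunctions

theorem exists_forall_forall {α : Type*} [Primcodable α] {m n : ℕ}
    {P : α → InfWord (Letter m n) → InfWord (Letter m n) → Prop}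
    (h : UniformlyExpressible {0, 1} fun a A => P a (A 0) (A 1)) :
    ∃ φ : α → HyperLTL (Fin m ⊕ Fin n), (Primrec fun a => (φ a).code) ∧
      ∀ a, (φ a).IsUniversal ∧ (φ a).IsClosed ∧
        (φ a).hyperproperty = {T | ∀ s ∈ T, ∀ t ∈ T, P a s t} := by
  obtain ⟨ψ, hcode, hvars, hψ⟩ := h
  have hlin (k : ℕ) {f : α → ℕ} (hf : Primrec f) : Primrec fun a => 3 * Nat.pair k (f a) + 1 :=
    primrec_mul_add 3 1 (Primrec₂.natPair.comp (.const k) hf)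
  refine ⟨fun a => .all 0 (.all 1 (.body (ψ a))),
    hlin 0 (hlin 1 (primrec_mul_add 3 0 hcode)), fun a => ⟨trivial, ?_, ?_⟩⟩
  · refine Set.eq_empty_of_forall_notMem fun x hx => ?_
    obtain rfl | rfl := hvars a hx.1.1
    exacts [hx.2 rfl, hx.1.2 rfl]
  · simp only [HyperLTL.hyperproperty, HyperLTL.Sat, hψ, Function.update_self]
    rfl

end UniformlyExpressible

/-! ## The hyperproperty of a cell rule -/

/-- The outputs of a trace after position `t`. -/
def InfWord.outputsAfter {m n : ℕ} (a : InfWord (Letter m n)) (t : ℕ) : InfWord (OutLetter n) :=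
  fun p => (a (p + t + 1)).2

theorem InfWord.outputsAfter_suffix {m n : ℕ} (a : InfWord (Letter m n)) (t k : ℕ) :
    (a.suffix t).outputsAfter k = a.outputsAfter (t + k) :=
  funext fun p => congrArg (fun j => (a j).2) (by omega)

/-- The mark of a session, the first occurrence of its only input, is at position `t`. -/
def MarkedAt (v : InfWord (InLetter 1)) (t : ℕ) : Prop :=
  v t 0 = true ∧ ∀ j < t, v j 0 = false

/-- The constraints on an ordered pair of sessions by which a session marked at `t` has to write
the `t`-th row of the run of `R` on `w` right after its mark. -/
structure CellRule.Consistent {n : ℕ} (R : CellRule (OutLetter n)) (w : List (OutLetter n))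
    (a b : InfWord (Letter 1 n)) : Prop where
  empty : ∀ j, (∀ k < j, a.inputs k 0 = false) → (a j).2 = fun _ => false
  init : MarkedAt a.inputs 0 → a.outputsAfter 0 = R.initRow w
  not_halted : ∀ t, MarkedAt a.inputs t → a.outputsAfter t 0 ∉ R.halted
  next : ∀ t, MarkedAt a.inputs t → MarkedAt b.inputs (t + 1) →
    b.outputsAfter (t + 1) = R.next (a.outputsAfter t)

/-- The trace sets in which all pairs of sessions satisfy the constraints. -/
def CellRule.hyperproperty {n : ℕ} (R : CellRule (OutLetter n)) (w : List (OutLetter n)) :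
    Hyperproperty 1 n :=
  {T | ∀ a ∈ T, ∀ b ∈ T, R.Consistent w a b}

namespace UniformlyExpressible

variable {n : ℕ} (R : CellRule (OutLetter n))

theorem empty_outputs :
    UniformlyExpressible {0, 1} fun (_ : List (OutLetter n)) (A : ℕ → InfWord (Letter 1 n)) =>
      ∀ j, (∀ k < j, (A 0).inputs k 0 = false) → (A 0 j).2 = fun _ => false :=
  (input_eq 0 (.inl rfl) 0 false).forall_of_forall_lt (output_eq (.inl rfl) 0 _)

theorem outputs_eq_initRow :
    UniformlyExpressible {0, 1} fun (w : List (OutLetter n)) (A : ℕ → InfWord (Letter 1 n)) =>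
      MarkedAt (A 0).inputs 0 → (A 0).outputsAfter 0 = R.initRow w :=
  ((input_eq 0 (.inl rfl) 0 true).imp
    ((outputs_eq_getD (.inl rfl) R.blank).suffix 1)).of_iff fun w A => by
      simp [MarkedAt, InfWord.inputs, InfWord.outputsAfter, InfWord.suffix, CellRule.initRow,
        funext_iff, add_comm 1]

theorem output_notMem_halted :
    UniformlyExpressible {0, 1} fun (_ : List (OutLetter n)) (A : ℕ → InfWord (Letter 1 n)) =>
      ∀ t, MarkedAt (A 0).inputs t → (A 0).outputsAfter t 0 ∉ R.halted := by
  have hnot : UniformlyExpressible {0, 1} fun (_ : List (OutLetter n))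
      (A : ℕ → InfWord (Letter 1 n)) => (A 0).outputsAfter 0 0 ∉ R.halted :=
    (forall_finite fun c : R.halted => (output_eq (.inl rfl) 1 c.1).not).of_iff fun _ A =>
      ⟨fun h hA => h ⟨_, hA⟩ rfl, fun h c hc => h (Set.mem_of_eq_of_mem hc c.2)⟩
  refine ((input_eq 0 (.inl rfl) 0 false).forall_of_forall_lt
    ((input_eq 0 (.inl rfl) 0 true).imp hnot)).of_iff fun _ A => ?_
  simp only [InfWord.outputsAfter_suffix, add_zero]
  exact forall_congr' fun t => ⟨fun h ht => h ht.2 ht.1, fun h ht ht' => h ⟨ht', ht⟩⟩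

theorem outputs_eq_next :
    UniformlyExpressible {0, 1} fun (_ : List (OutLetter n)) (A : ℕ → InfWord (Letter 1 n)) =>
      (A 1).outputsAfter 1 = R.next ((A 0).outputsAfter 0) := by
  have hboundary := forall_finite (X := {0, 1}) (α := List (OutLetter n)) (m := 1)
    fun c : OutLetter n × OutLetter n =>
      (output_eq (x := 0) (.inl rfl) 1 c.1).imp <| (output_eq (.inl rfl) 2 c.2).imp <|
        output_eq (x := 1) (.inr rfl) 2 (R.boundary c.1 c.2)
  have hinterior := forall_finite (X := {0, 1}) (α := List (OutLetter n)) (m := 1)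
    fun d : OutLetter n => (output_eq (x := 0) (.inl rfl) 1 d).imp <| always <| forall_finite
      fun c : OutLetter n × OutLetter n × OutLetter n =>
        (output_eq (x := 0) (.inl rfl) 1 c.1).imp <| (output_eq (.inl rfl) 2 c.2.1).imp <|
          (output_eq (.inl rfl) 3 c.2.2).imp <|
            output_eq (x := 1) (.inr rfl) 3 (R.interior d c.1 c.2.1 c.2.2)
  refine (hboundary.and hinterior).of_iff fun _ A => ?_
  constructor
  · rintro ⟨h₀, h₁⟩
    funext p
    cases p with
    | zero => exact h₀ (_, _) rfl rfl
    | succ p => exact h₁ _ rfl p (_, _, _) rfl rfl rfl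
  · intro h
    refine ⟨?_, ?_⟩
    · rintro ⟨_, _⟩ rfl rfl
      exact congrFun h 0
    · rintro _ rfl p ⟨_, _, _⟩ rfl rfl rfl
      exact congrFun h (p + 1)

theorem outputs_eq_next_of_markedAt :
    UniformlyExpressible {0, 1} fun (_ : List (OutLetter n)) (A : ℕ → InfWord (Letter 1 n)) =>
      ∀ t, MarkedAt (A 0).inputs t → MarkedAt (A 1).inputs (t + 1) →
        (A 1).outputsAfter (t + 1) = R.next ((A 0).outputsAfter t) := by
  refine (((input_eq 0 (.inl rfl) 0 false).and (input_eq 0 (.inr rfl) 0 false)).forall_of_forall_lt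
    ((input_eq 0 (.inl rfl) 0 true).imp <| (input_eq 0 (.inr rfl) 0 false).imp <|
      (input_eq 0 (.inr rfl) 1 true).imp (outputs_eq_next R))).of_iff fun _ A => ?_
  refine forall_congr' fun t => ?_
  simp only [InfWord.outputsAfter_suffix]
  simp only [MarkedAt, InfWord.inputs, InfWord.suffix]
  grind

theorem consistent :
    UniformlyExpressible {0, 1} fun w (A : ℕ → InfWord (Letter 1 n)) =>
      R.Consistent w (A 0) (A 1) :=
  (empty_outputs.and <| (outputs_eq_initRow R).and <| (output_notMem_halted R).and <|
    outputs_eq_next_of_markedAt R).of_iff fun _ _ =>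
      ⟨fun ⟨h₁, h₂, h₃, h₄⟩ => ⟨h₁, h₂, h₃, h₄⟩, fun ⟨h₁, h₂, h₃, h₄⟩ => ⟨h₁, h₂, h₃, h₄⟩⟩

end UniformlyExpressible

theorem MarkedAt.findIdx_first {v : InfWord (InLetter 1)} {t : ℕ} (h : MarkedAt v t) (p : ℕ) :
    (v.first (p + t + 1)).findIdx (· 0) = t := by
  rw [List.findIdx_eq (by rw [InfWord.length_first]; omega)]
  exact ⟨(congrFun (v.getElem_first _) 0).trans h.1,
    fun j hj => (congrFun (v.getElem_first _) 0).trans (h.2 j hj)⟩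

theorem exists_markedAt_lt_or (v : InfWord (InLetter 1)) (j : ℕ) :
    (∃ t < j, MarkedAt v t) ∨ ∀ k < j, v k 0 = false := by
  classical
  by_cases h : ∃ t < j, v t 0 = true
  · exact .inl ⟨Nat.find h, (Nat.find_spec h).1, (Nat.find_spec h).2, fun k hk =>
      Bool.eq_false_iff.2 fun hv => Nat.find_min h hk ⟨hk.trans (Nat.find_spec h).1, hv⟩⟩
  · exact .inr (by simpa using h)

/-- The session in which the input occurs exactly at position `t`. -/
def markSession (t : ℕ) : InfWord (InLetter 1) := fun j _ => decide (j = t)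

theorem markedAt_markSession (t : ℕ) : MarkedAt (markSession t) t :=
  ⟨decide_eq_true rfl, fun _ hj => decide_eq_false hj.ne⟩

namespace CellRule

variable {n : ℕ} (R : CellRule (OutLetter n)) (w : List (OutLetter n))

/-- The strategy that writes empty outputs up to the mark of a session, and then, if the mark is at
position `t`, the `t`-th row of the run of `R` on `w`. -/
def answer (v : List (InLetter 1)) : OutLetter n :=
  if v.findIdx (· 0) < v.length then
    R.row w (v.findIdx (· 0)) (v.length - (v.findIdx (· 0) + 1))
  else fun _ => false

theorem primrec_answer : Primrec (R.answer w) := by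
  have hidx : Primrec fun v : List (InLetter 1) => v.findIdx (· 0) :=
    Primrec.list_findIdx .id ((Primrec.dom_finite fun x : InLetter 1 => x 0).comp .snd)
  exact Primrec.ite (Primrec.nat_lt.comp hidx .list_length)
    ((R.primrec_row w).comp hidx (Primrec.nat_sub.comp .list_length (Primrec.succ.comp hidx)))
    (.const _)

theorem answer_first_of_markedAt {v : InfWord (InLetter 1)} {t : ℕ} (h : MarkedAt v t) (p : ℕ) :
    R.answer w (v.first (p + t + 1)) = R.row w t p := by
  rw [answer, h.findIdx_first, InfWord.length_first, if_pos (by omega), add_assoc,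
    Nat.add_sub_cancel]

theorem answer_first_of_forall_eq_false {v : InfWord (InLetter 1)} {j : ℕ}
    (h : ∀ k < j, v k 0 = false) : R.answer w (v.first j) = fun _ => false := by
  rw [answer, if_neg]
  rw [List.findIdx_lt_length]
  simpa only [InfWord.first, List.mem_map, List.mem_range, exists_exists_and_eq_and, not_exists,
    not_and, Bool.not_eq_true] using h

theorem outputsAfter_respond_answer {v : InfWord (InLetter 1)} {t : ℕ} (h : MarkedAt v t) :
    (respond (R.answer w) v).outputsAfter t = R.row w t :=
  funext (R.answer_first_of_markedAt w h)

variable {R w}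

theorem consistent_respond_answer (h : ¬ R.Halts w) (u v : InfWord (InLetter 1)) :
    R.Consistent w (respond (R.answer w) u) (respond (R.answer w) v) where
  empty _ := R.answer_first_of_forall_eq_false w
  init := R.outputsAfter_respond_answer w
  not_halted t ht hu := h ⟨t, R.outputsAfter_respond_answer w ht ▸ hu⟩
  next t ht ht' := by
    rw [R.outputsAfter_respond_answer w (v := u) ht, R.outputsAfter_respond_answer w (v := v) ht',
      row_succ]

theorem outputsAfter_eq_row {T : Set (InfWord (Letter 1 n))} (hT : T ∈ R.hyperproperty w)
    (hmarks : ∀ t, ∃ a ∈ T, MarkedAt a.inputs t) {a : InfWord (Letter 1 n)} (ha : a ∈ T) {t : ℕ}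
    (hat : MarkedAt a.inputs t) : a.outputsAfter t = R.row w t := by
  induction t generalizing a with
  | zero => exact (hT a ha a ha).init hat
  | succ t ih =>
    obtain ⟨b, hb, hbt⟩ := hmarks t
    rw [(hT b hb a ha).next t hbt hat, ih hb hbt, row_succ]

theorem eq_respond_answer {T : Set (InfWord (Letter 1 n))} (hT : T ∈ R.hyperproperty w)
    (hmarks : ∀ t, ∃ a ∈ T, MarkedAt a.inputs t) {a : InfWord (Letter 1 n)} (ha : a ∈ T) :
    a = respond (R.answer w) a.inputs := by
  funext j
  refine Prod.ext rfl ?_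
  change (a j).2 = R.answer w (a.inputs.first j)
  obtain ⟨t, htj, ht⟩ | hfalse := exists_markedAt_lt_or a.inputs j
  · obtain ⟨p, rfl⟩ := Nat.exists_eq_add_of_le' (Nat.succ_le_of_lt htj)
    rw [Nat.succ_eq_add_one, ← add_assoc, R.answer_first_of_markedAt w ht,
      ← outputsAfter_eq_row hT hmarks ha ht]
    rfl
  · rw [R.answer_first_of_forall_eq_false w hfalse, (hT a ha a ha).empty j hfalse]

theorem not_halts_of_exists_mem {T : Set (InfWord (Letter 1 n))} (hT : T ∈ R.hyperproperty w)
    (hmarks : ∀ t, ∃ a ∈ T, MarkedAt a.inputs t) : ¬ R.Halts w := by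
  rintro ⟨t, ht⟩
  obtain ⟨a, ha, hat⟩ := hmarks t
  exact (hT a ha a ha).not_halted t hat (outputsAfter_eq_row hT hmarks ha hat ▸ ht)

variable (R w)

theorem enforceable_hyperproperty_iff : Enforceable (R.hyperproperty w) ↔ ¬ R.Halts w := by
  have hmarks {T : Set (InfWord (Letter 1 n))} (h : ∀ t, ∃ a ∈ T, a.inputs = markSession t)
      (t : ℕ) : ∃ a ∈ T, MarkedAt a.inputs t :=
    (h t).imp fun _ ⟨ha, hat⟩ => ⟨ha, hat ▸ markedAt_markSession t⟩
  refine ⟨fun h => ?_, fun h => enforceable_of_forall_eq_respond (R.primrec_answer w).to_comp ?_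
    fun T hT hV a => eq_respond_answer hT (hmarks hV)⟩
  · obtain ⟨T, hT, hV⟩ := h.exists_mem_forall_exists_inputs_eq markSession
    exact not_halts_of_exists_mem hT (hmarks hV)
  · rintro V _ ⟨i, rfl⟩ _ ⟨j, rfl⟩
    exact consistent_respond_answer h _ _

end CellRule

theorem theorem1_general : ∃ n : ℕ, ¬ ∃ P : ℕ → Prop, REPred P ∧
    ∀ φ : HyperLTL (Fin 1 ⊕ Fin n), φ.IsUniversal → φ.IsClosed →
      (P φ.code ↔ Enforceable φ.hyperproperty) := by
  obtain ⟨n, R, hR⟩ := exists_cellRule_not_rePred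
  obtain ⟨φ, hcode, hφ⟩ := (UniformlyExpressible.consistent R).exists_forall_forall
  refine ⟨n, fun ⟨P, hP, h⟩ => hR ((rePred_comp hP hcode.to_comp).of_eq fun w => ?_)⟩
  obtain ⟨huniversal, hclosed, hhyper⟩ := hφ w
  rw [h _ huniversal hclosed, hhyper]
  exact R.enforceable_hyperproperty_iff w

/-- No algorithm decides, given the numbers `m` and `n` of inputs and outputs and a closed universal
HyperLTL formula over them, whether the formula is enforceable in the sequential model. -/
theorem theorem1 :
    ¬ ∃ f : ℕ × ℕ × ℕ → Bool, Computable f ∧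
      ∀ (m n : ℕ) (φ : HyperLTL (Fin m ⊕ Fin n)), φ.IsUniversal → φ.IsClosed →
        (f (m, n, φ.code) = true ↔ Enforceable φ.hyperproperty) := by
  rintro ⟨f, hf, h⟩
  obtain ⟨n, hn⟩ := theorem1_general
  have hcode : Computable fun c => f (1, n, c) :=
    hf.comp ((Computable.const 1).pair ((Computable.const n).pair .id))
  exact hn ⟨_, (ComputablePred.computable_iff.2 ⟨_, hcode, rfl⟩).to_re, h 1 n⟩
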